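/- Finite words are finite sequences of letters of an alphabet; a palindrome is a nonempty finite word that equals its reverse. For a nonempty finite word $u$, the palindromic length $\mathrm{PL}(u)$ is the minimal number $k$ such that $u=p_1p_2\cdots p_k$ for some palindromes $p_1,\dots,p_k$. A factor of an infinite word $x=x_1x_2x_3\cdots$ is a finite block $x_ix_{i+1}\cdots x_j$ of consecutive letters. The infinite word $x$ is ultimately periodic if $x=uv^{\infty}=uvvv\cdots$ for some finite words $u,v$ with $v$ nonempty, and aperiodic otherwise. Theorem (the Frid–Puzynina–Zamboni conjecture). Let $x$ be an infinite word. If there is an integer $k$ such that $\mathrm{PL}(u)\le k$ for every nonempty factor $u$ of $x$, then $x$ is ultimately periodic. Equivalently, if $x$ is aperiodic, then for every integer $k$ there is a nonempty factor $u$ of $x$ with $\mathrm{PL}(u)>k$. -/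

import Mathlib

/-! Finite words over an alphabet `α` are lists, infinite words are streams `Stream' α`. -/

/-- A finite word is a palindrome if it is nonempty and equal to its reverse. -/
def IsPalindromeWord {α : Type*} (p : List α) : Prop :=
  p ≠ [] ∧ p.reverse = p

/-- `ps` is a factorization of the finite word `u` into palindromes. -/
def IsPalindromicFactorization {α : Type*} (ps : List (List α)) (u : List α) : Prop :=
  (∀ p ∈ ps, IsPalindromeWord p) ∧ ps.flatten = u

/-- The palindromic length of a finite word: the minimal number of palindromes whose
concatenation is the word. The set below is never empty, see
`exists_isPalindromicFactorization`. -/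
noncomputable def palindromicLength {α : Type*} (u : List α) : ℕ :=
  sInf {k : ℕ | ∃ ps : List (List α), ps.length = k ∧ IsPalindromicFactorization ps u}

/-- Every finite word is the concatenation of its letters, which are palindromes. -/
theorem exists_isPalindromicFactorization {α : Type*} (u : List α) :
    ∃ ps : List (List α), ps.length = u.length ∧ IsPalindromicFactorization ps u := by
  refine ⟨u.map (fun a => [a]), by simp, ?_, ?_⟩
  · intro p hp
    obtain ⟨a, _, rfl⟩ := List.mem_map.1 hp
    exact ⟨by simp, by simp⟩
  · induction u with
    | nil => rfl
    | cons a l ih => simpa using ih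

/-- The minimum in the definition of the palindromic length is attained. -/
theorem exists_factorization_length_eq_palindromicLength {α : Type*} (u : List α) :
    ∃ ps : List (List α), ps.length = palindromicLength u ∧ IsPalindromicFactorization ps u :=
  Nat.sInf_mem (s := {k : ℕ | ∃ ps : List (List α), ps.length = k ∧
    IsPalindromicFactorization ps u}) ⟨_, exists_isPalindromicFactorization u⟩

/-- `u` is a nonempty factor of the infinite word `x`: a nonempty block of consecutive letters. -/
def IsNonemptyFactor {α : Type*} (u : List α) (x : Stream' α) : Prop :=
  u ≠ [] ∧ ∃ i n : ℕ, u = (x.drop i).take n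

/-- `x` is ultimately periodic: `x = u v v v ⋯` for finite words `u` and `v`, with `v` nonempty. -/
def IsUltimatelyPeriodic {α : Type*} (x : Stream' α) : Prop :=
  ∃ (u v : List α) (hv : v ≠ []), x = Stream'.appendStream' u (Stream'.cycle v hv)

/-- An infinite word is aperiodic if it is not ultimately periodic. -/
def IsAperiodic {α : Type*} (x : Stream' α) : Prop :=
  ¬ IsUltimatelyPeriodic x

/-! Length is replaced by a cost that treats periodic stretches as cheap: a letter costs 1, costs
add under concatenation, and any factor of `v v v ⋯` costs three times `v`. The least cost is
subadditive, monotone under factors, invariant under reversal, and grows by at most one per letter.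
If a word `w` ends at two positions, the block between them costs at least a third of `cost w`
(`EndsAt.cost_le`), so expensive words recur only at costly distances.

Two facts carry the proof. First, bounded cost of the factors forces ultimate periodicity
(`isUltimatelyPeriodic_of_cost_le`). Second, a word of a suitable cost depending only on `k` has a
prefix that is not a product of `k` palindromes (`exists_prefix_not_palindromic`).

For the second, consider products of `k` palindromes none of whose costs lies strictly between `lo`
and `hi`. Cheap palindromes move the endpoint little; expensive ones reflect a known word `u` to a
copy of `u.reverse` near the new endpoint. An expensive word has few minimal right extensions of
given cost inside `W` (`exists_cover_extensions`), so a few expensive words locate all reachable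
endpoints up to small cost (`exists_words`). Each of them ends at most once in an interval of
moderate cost, so some costly subinterval contains no reachable endpoint. Repeating this for `k + 1`
nested scales gives a position missed by every path that avoids one of `k + 1` disjoint cost gaps;
since `k` palindromes cannot meet all the gaps, that position is missed altogether. -/

namespace PowerCost

/-! ### Blocks of consecutive letters -/

variable {α : Type*}

/-- The block of letters of `W` at the positions `a, a + 1, …, b - 1`. -/
def block (W : List α) (a b : ℕ) : List α := (W.take b).drop a

theorem getElem?_block (W : List α) (a b i : ℕ) :
    (block W a b)[i]? = if a + i < b then W[a + i]? else none := by
  simp [block, List.getElem?_take]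

theorem length_block (W : List α) (a b : ℕ) : (block W a b).length = min b W.length - a := by
  simp [block]

theorem length_block_of_le {W : List α} {a b : ℕ} (h : b ≤ W.length) :
    (block W a b).length = b - a := by
  rw [length_block, min_eq_left h]

theorem block_append {W : List α} {a b c : ℕ} (hab : a ≤ b) (hbc : b ≤ c) (hc : c ≤ W.length) :
    block W a b ++ block W b c = block W a c := by
  apply List.ext_getElem?
  intro i
  rw [List.getElem?_append, length_block_of_le (hbc.trans hc)]
  simp only [getElem?_block]
  split_ifs <;> first | rfl | (congr 1; omega)

theorem block_self_length (W : List α) : block W 0 W.length = W := by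
  simp [block]

theorem block_of_le (W : List α) {a b : ℕ} (h : b ≤ a) : block W a b = [] := by
  apply List.ext_getElem?
  intro i
  rw [getElem?_block, if_neg (by omega)]
  rfl

theorem block_block_infix (W : List α) {a a' b b' : ℕ} (ha : a ≤ a') (hb : b' ≤ b) :
    block W a' b' <:+: block W a b := by
  have h : block W a' b' = ((block W a b).take (b' - a)).drop (a' - a) := by
    apply List.ext_getElem?
    intro i
    simp only [List.getElem?_drop, List.getElem?_take, getElem?_block]
    split_ifs <;> first | rfl | (congr 1; omega)
  rw [h]
  exact (List.drop_suffix _ _).isInfix.trans (List.take_prefix _ _).isInfix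

theorem block_infix (W : List α) (a b : ℕ) : block W a b <:+: W :=
  (List.drop_suffix _ _).isInfix.trans (List.take_prefix _ _).isInfix

theorem infix_iff_block {u W : List α} :
    u <:+: W ↔ ∃ s, s + u.length ≤ W.length ∧ block W s (s + u.length) = u := by
  constructor
  · rintro ⟨p, q, rfl⟩
    refine ⟨p.length, by simp, ?_⟩
    apply List.ext_getElem?
    intro i
    rw [getElem?_block]
    split_ifs with h
    · rw [List.append_assoc, List.getElem?_append_right (by omega),
        List.getElem?_append_left (by omega)]
      congr 1; omega
    · rw [List.getElem?_eq_none (by omega)]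
  · rintro ⟨s, -, h⟩
    rw [← h]
    exact block_infix _ _ _

/-! ### Runs and the cost of a word -/

/-- `w` is a factor of the periodic word `v v v ⋯`. -/
def IsRunOf (v w : List α) : Prop :=
  v ≠ [] ∧ ∃ s, ∀ i, i < w.length → w[i]? = v[(s + i) % v.length]?

theorem IsRunOf.infix {v w u : List α} (h : IsRunOf v w) (hu : u <:+: w) : IsRunOf v u := by
  obtain ⟨hv, s, hs⟩ := h
  obtain ⟨t, ht, hb⟩ := infix_iff_block.1 hu
  refine ⟨hv, s + t, fun i hi => ?_⟩
  rw [← hb, getElem?_block, if_pos (by omega), hs _ (by omega), add_assoc]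

theorem IsRunOf.reverse {v w : List α} (h : IsRunOf v w) : IsRunOf v.reverse w.reverse := by
  obtain ⟨hv, s, hs⟩ := h
  have hL : 0 < v.length := List.length_pos_iff.2 hv
  -- Modulo `v.length` this offset is `-(s + w.length)`, where the reversed root starts retracing
  -- the run.
  refine ⟨by simpa using hv, (v.length - 1) * (s + w.length), fun i hi => ?_⟩
  rw [List.length_reverse] at hi
  rw [List.getElem?_reverse hi, hs _ (by omega), List.length_reverse,
    List.getElem?_reverse (Nat.mod_lt _ hL)]
  congr 1
  set L := v.length
  have h1 := Nat.mod_lt (s + (w.length - 1 - i)) hL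
  have h2 := Nat.mod_lt ((L - 1) * (s + w.length) + i) hL
  have h3 : (s + (w.length - 1 - i)) + ((L - 1) * (s + w.length) + i) + 1
      = L * (s + w.length) := by
    obtain ⟨m, hm⟩ : ∃ m, L = m + 1 := ⟨L - 1, by omega⟩
    rw [hm, Nat.add_sub_cancel, Nat.add_mul]
    omega
  have e1 := Nat.div_add_mod (s + (w.length - 1 - i)) L
  have e2 := Nat.div_add_mod ((L - 1) * (s + w.length) + i) L
  set q1 := (s + (w.length - 1 - i)) / L
  set q2 := ((L - 1) * (s + w.length) + i) / L
  set r1 := (s + (w.length - 1 - i)) % L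
  set r2 := ((L - 1) * (s + w.length) + i) % L
  have h4 : L * (q1 + q2) + (r1 + r2 + 1) = L * (s + w.length) := by
    rw [← h3, ← e1, ← e2]; ring
  have h5 : L ∣ r1 + r2 + 1 :=
    (Nat.dvd_add_right (Dvd.intro (q1 + q2) rfl)).1 (Dvd.intro _ h4.symm)
  obtain ⟨m, hm⟩ := h5
  have : m = 1 := by
    rcases Nat.lt_trichotomy m 1 with h | h | h
    · have : m = 0 := by omega
      subst this; omega
    · exact h
    · have : L * 2 ≤ L * m := Nat.mul_le_mul_left _ h
      omega
  subst this
  omega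

/-- `HasCost h w`: the word `w` can be built with total cost `h`. A letter costs `1`, costs add
up under concatenation, and a factor of `v v v ⋯` costs three times as much as `v`. -/
inductive HasCost : ℕ → List α → Prop
  | nil : HasCost 0 []
  | letter (a : α) : HasCost 1 [a]
  | append {a b : ℕ} {u v : List α} : HasCost a u → HasCost b v → HasCost (a + b) (u ++ v)
  | run {a : ℕ} {v w : List α} : HasCost a v → IsRunOf v w → HasCost (3 * a) w

theorem HasCost.exists_of_infix {h : ℕ} {w u : List α} (hw : HasCost h w) (hu : u <:+: w) :
    ∃ h' ≤ h, HasCost h' u := by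
  induction hw generalizing u with
  | nil =>
    rw [List.infix_nil] at hu
    exact ⟨0, le_rfl, hu ▸ .nil⟩
  | letter a =>
    rw [infix_iff_block] at hu
    obtain ⟨s, hs, hb⟩ := hu
    rcases Nat.eq_zero_or_pos u.length with h0 | h0
    · exact ⟨0, by omega, (List.length_eq_zero_iff.1 h0) ▸ .nil⟩
    · have h1 : u.length = 1 ∧ s = 0 := by simp at hs; omega
      rw [h1.2, h1.1] at hb
      refine ⟨1, le_rfl, ?_⟩
      rw [← hb]
      exact .letter a
  | @append a b p q hp hq ihp ihq =>
    rcases List.infix_append_iff.1 hu with h | h | ⟨t1, t2, rfl, h1, h2⟩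
    · obtain ⟨h', hle, hc⟩ := ihp h
      exact ⟨h', by omega, hc⟩
    · obtain ⟨h', hle, hc⟩ := ihq h
      exact ⟨h', by omega, hc⟩
    · obtain ⟨x, hx, hcx⟩ := ihp h1.isInfix
      obtain ⟨y, hy, hcy⟩ := ihq h2.isInfix
      exact ⟨x + y, by omega, hcx.append hcy⟩
  | @run a v w hv hr ih => exact ⟨3 * a, le_rfl, .run hv (hr.infix hu)⟩

theorem HasCost.reverse {h : ℕ} {w : List α} (hw : HasCost h w) : HasCost h w.reverse := by
  induction hw with
  | nil => exact .nil
  | letter a => exact .letter a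
  | append _ _ ihu ihv =>
    rw [List.reverse_append, Nat.add_comm]
    exact ihv.append ihu
  | run _ hr ih => exact .run ih hr.reverse

theorem exists_hasCost (w : List α) : ∃ h, HasCost h w := by
  induction w with
  | nil => exact ⟨0, .nil⟩
  | cons a w ih =>
    obtain ⟨h, hw⟩ := ih
    exact ⟨1 + h, (HasCost.letter a).append hw⟩

theorem HasCost.eq_nil {h : ℕ} {w : List α} (hw : HasCost h w) (h0 : h = 0) : w = [] := by
  induction hw with
  | nil => rfl
  | letter a => omega
  | append _ _ ihu ihv => rw [ihu (by omega), ihv (by omega)]; rfl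
  | run _ hr ih => exact absurd (ih (by omega)) hr.1

/-- The least cost of a word. -/
noncomputable def cost (w : List α) : ℕ := sInf {h | HasCost h w}

theorem hasCost_cost (w : List α) : HasCost (cost w) w := Nat.sInf_mem (exists_hasCost w)

theorem HasCost.cost_le {h : ℕ} {w : List α} (hw : HasCost h w) : cost w ≤ h := Nat.sInf_le hw

theorem cost_nil : cost ([] : List α) = 0 := Nat.le_zero.1 HasCost.nil.cost_le

theorem cost_append_le (u v : List α) : cost (u ++ v) ≤ cost u + cost v :=
  ((hasCost_cost u).append (hasCost_cost v)).cost_le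

theorem cost_mono {u w : List α} (h : u <:+: w) : cost u ≤ cost w := by
  obtain ⟨h', hle, hc⟩ := (hasCost_cost w).exists_of_infix h
  exact hc.cost_le.trans hle

theorem cost_reverse (w : List α) : cost w.reverse = cost w := by
  apply le_antisymm (hasCost_cost w).reverse.cost_le
  simpa using (hasCost_cost w.reverse).reverse.cost_le

theorem cost_run_le {v w : List α} (h : IsRunOf v w) : cost w ≤ 3 * cost v :=
  (HasCost.run (hasCost_cost v) h).cost_le

theorem cost_le_one {w : List α} (h : w.length ≤ 1) : cost w ≤ 1 := by
  match w, h with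
  | [], _ => rw [cost_nil]; omega
  | [a], _ => exact (HasCost.letter a).cost_le

/-! ### Costs of blocks -/

/-- The least cost of a block. -/
noncomputable def blockCost (W : List α) (a b : ℕ) : ℕ := cost (block W a b)

theorem blockCost_mono (W : List α) {a a' b b' : ℕ} (ha : a ≤ a') (hb : b' ≤ b) :
    blockCost W a' b' ≤ blockCost W a b := cost_mono (block_block_infix W ha hb)

theorem blockCost_add {W : List α} {a b c : ℕ} (hab : a ≤ b) (hbc : b ≤ c) (hc : c ≤ W.length) :
    blockCost W a c ≤ blockCost W a b + blockCost W b c := by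
  unfold blockCost
  rw [← block_append hab hbc hc]
  exact cost_append_le _ _

theorem blockCost_of_le (W : List α) {a b : ℕ} (h : b ≤ a) : blockCost W a b = 0 := by
  rw [blockCost, block_of_le W h, cost_nil]

theorem blockCost_succ {W : List α} {a b : ℕ} (hb : b < W.length) :
    blockCost W a (b + 1) ≤ blockCost W a b + 1 := by
  rcases le_or_gt a b with h | h
  · refine (blockCost_add h (Nat.le_add_right b 1) hb).trans ?_
    have : blockCost W b (b + 1) ≤ 1 := cost_le_one (by rw [length_block]; omega)
    omega
  · rw [blockCost_of_le W (by omega : b + 1 ≤ a)]; omega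

/-- Discrete intermediate value property of the cost. -/
theorem exists_blockCost_eq {W : List α} {a b t : ℕ} (hb : b ≤ W.length)
    (ht : t ≤ blockCost W a b) :
    ∃ e ≤ b, blockCost W a e = t ∧ ∀ e' < e, blockCost W a e' < t := by
  classical
  have hex : ∃ e, t ≤ blockCost W a e := ⟨b, ht⟩
  refine ⟨Nat.find hex, Nat.find_min' hex ht, le_antisymm ?_ (Nat.find_spec hex),
    fun e' he' => not_le.1 (Nat.find_min hex he')⟩
  rcases Nat.eq_zero_or_pos (Nat.find hex) with h0 | h0
  · rw [h0, blockCost_of_le W (Nat.zero_le a)]; exact Nat.zero_le _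
  · have h1 := not_le.1 (Nat.find_min hex (Nat.sub_lt h0 one_pos))
    have h2 : Nat.find hex - 1 < W.length := by
      have := Nat.find_min' hex ht; omega
    have h3 := blockCost_succ (a := a) h2
    rw [Nat.sub_add_cancel h0] at h3
    omega

/-- In an interval with period `p`, all blocks of length `p` control the cost. -/
theorem blockCost_le_of_periodic {W : List α} {a b p t : ℕ} (hp : 0 < p) (hb : b ≤ W.length)
    (hper : ∀ i, a ≤ i → i + p < b → W[i]? = W[i + p]?) (hat : a ≤ t) (htb : t + p ≤ b) :
    blockCost W a b ≤ 3 * blockCost W t (t + p) := by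
  apply cost_run_le
  have hlen : (block W t (t + p)).length = p := by rw [length_block]; omega
  have hmul : ∀ n i, a ≤ i → i + n * p < b → W[i]? = W[i + n * p]? := by
    intro n
    induction n with
    | zero => intro i _ _; simp
    | succ n ih =>
      intro i hi hlt
      rw [Nat.succ_mul] at hlt
      rw [ih i hi (by omega), hper _ (by omega) (by omega)]
      congr 1; ring
  have hmod : ∀ i j, a ≤ i → i ≤ j → j < b → i ≡ j [MOD p] → W[i]? = W[j]? := by
    intro i j hi hij hj h
    obtain ⟨n, hn⟩ := (Nat.modEq_iff_dvd' hij).1 h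
    have : j = i + n * p := by rw [Nat.mul_comm]; omega
    rw [this]
    exact hmul n i hi (by omega)
  -- The offset is `a - t` modulo `p`, with `t * p` added to keep the subtraction in `ℕ` harmless.
  refine ⟨fun h => by rw [h] at hlen; simp at hlen; omega, a + t * p - t, fun i hi => ?_⟩
  rw [length_block_of_le hb] at hi
  have htp : t ≤ t * p := Nat.le_mul_of_pos_right t hp
  have hlt := Nat.mod_lt (a + t * p - t + i) hp
  rw [getElem?_block, if_pos (by omega), hlen, getElem?_block, if_pos (by omega)]
  have hcong : a + i ≡ t + (a + t * p - t + i) % p [MOD p] := by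
    have h1 : t + (a + t * p - t + i) % p ≡ t + (a + t * p - t + i) [MOD p] :=
      Nat.ModEq.add_left _ (Nat.mod_modEq _ _)
    have h2 : t + (a + t * p - t + i) = a + i + t * p := by omega
    rw [h2] at h1
    refine (h1.trans ?_).symm
    simp [Nat.ModEq]
  rcases le_total (a + i) (t + (a + t * p - t + i) % p) with h | h
  · exact hmod _ _ (by omega) h (by omega) hcong
  · exact (hmod _ _ (by omega) h (by omega) hcong.symm).symm

/-! ### Tight words and repeated occurrences -/

/-- `u` has cost at least `θ`, but all its proper prefixes have smaller cost. -/
def Tight (θ : ℕ) (u : List α) : Prop :=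
  θ ≤ cost u ∧ ∀ n < u.length, cost (u.take n) < θ

theorem take_block (W : List α) {a b n : ℕ} (h : a + n ≤ b) :
    (block W a b).take n = block W a (a + n) := by
  apply List.ext_getElem?
  intro i
  simp only [List.getElem?_take, getElem?_block]
  split_ifs <;> first | rfl | (exfalso; omega)

theorem Tight.length_le {θ : ℕ} {u W : List α} {d e : ℕ} (hu : Tight θ u)
    (hb : block W d (d + u.length) = u) (hde : d ≤ e) (he : θ ≤ blockCost W d e) :
    d + u.length ≤ e := by
  by_contra! hlt
  have h1 := hu.2 (e - d) (by omega)
  rw [← hb, take_block W (by omega), Nat.add_sub_cancel' hde] at h1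
  exact absurd he (not_le.2 h1)

theorem Tight.cost_eq {θ : ℕ} {u : List α} (hθ : 0 < θ) (hu : Tight θ u) : cost u = θ := by
  refine le_antisymm ?_ hu.1
  have hlen : 0 < u.length := by
    by_contra! h
    have h0 := hu.1
    rw [List.length_eq_zero_iff.1 (Nat.le_zero.1 h), cost_nil] at h0
    omega
  have h1 := hu.2 (u.length - 1) (by omega)
  have h2 := cost_append_le (u.take (u.length - 1)) (u.drop (u.length - 1))
  have h3 : cost (u.drop (u.length - 1)) ≤ 1 := cost_le_one (by rw [List.length_drop]; omega)
  rw [List.take_append_drop] at h2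
  omega

theorem exists_tight {W : List α} {a b θ : ℕ} (hab : a ≤ b) (hb : b ≤ W.length)
    (ht : θ ≤ blockCost W a b) :
    ∃ u, Tight θ u ∧ block W a (a + u.length) = u ∧ a + u.length ≤ b := by
  obtain ⟨e, heb, he, hlt⟩ := exists_blockCost_eq hb ht
  have hlen : (block W a e).length = e - a := length_block_of_le (heb.trans hb)
  rcases le_or_gt a e with h | h
  · refine ⟨block W a e, ⟨he.ge, fun n hn => ?_⟩, ?_, ?_⟩
    · rw [take_block W (by omega)]
      exact hlt _ (by omega)
    · rw [hlen, Nat.add_sub_cancel' h]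
    · omega
  · have h0 : θ = 0 := by rw [← he, blockCost_of_le W h.le]
    refine ⟨[], ⟨by omega, fun n hn => by simp at hn⟩, ?_, by simpa using hab⟩
    simp [block_of_le]

/-- The word `w` occurs in `L` just before the position `d`. -/
def EndsAt (L w : List α) (d : ℕ) : Prop :=
  w.length ≤ d ∧ block L (d - w.length) d = w

theorem EndsAt.getElem?_eq {L w : List α} {d d' i : ℕ} (h : EndsAt L w d) (h' : EndsAt L w d')
    (hd : d ≤ d') (hi : d ≤ i + w.length) (hid : i < d) : L[i]? = L[i + (d' - d)]? := by
  have e1 := congrArg (fun z => z[i + w.length - d]?) h.2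
  have e2 := congrArg (fun z => z[i + w.length - d]?) h'.2
  have := h.1
  have := h'.1
  simp only [getElem?_block] at e1 e2
  rw [if_pos (by omega)] at e1 e2
  rw [show i = d - w.length + (i + w.length - d) by omega, e1, ← e2]
  congr 1; omega

/-- Two occurrences of `w` at distance `d' - d` make the stretch from the start of the first to the
end of the second periodic with that period, and the block between the two ends is one full period.
-/
theorem EndsAt.cost_le {L w : List α} {d d' : ℕ} (h : EndsAt L w d) (h' : EndsAt L w d')
    (hd : d < d') (hL : d' ≤ L.length) : cost w ≤ 3 * blockCost L d d' := by
  have h1 : blockCost L (d - w.length) d' ≤ 3 * blockCost L d (d + (d' - d)) := by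
    have := h.1
    apply blockCost_le_of_periodic (by omega) hL _ (by omega) (by omega)
    intro i hi hlt
    exact h.getElem?_eq h' hd.le (by omega) (by omega)
  rw [Nat.add_sub_cancel' hd.le] at h1
  refine le_trans ?_ h1
  conv_lhs => rw [← h.2]
  exact blockCost_mono L le_rfl hd.le

/-- The word `w` ends in `L` at position `d`, where it is followed by the tight word `u`. -/
def ExtendsAt (L w : List α) (θ d : ℕ) (u : List α) : Prop :=
  EndsAt L w d ∧ d + u.length ≤ L.length ∧ block L d (d + u.length) = u ∧ Tight θ u

theorem ExtendsAt.eq {L w : List α} {θ d : ℕ} {u u' : List α} (h : ExtendsAt L w θ d u)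
    (h' : ExtendsAt L w θ d u') : u = u' := by
  have key : ∀ {u u'}, ExtendsAt L w θ d u → ExtendsAt L w θ d u' → u.length ≤ u'.length := by
    intro u u' h h'
    have := h.2.2.2.length_le (e := d + u'.length) h.2.2.1
      (Nat.le_add_right _ _) (by rw [blockCost, h'.2.2.1]; exact h'.2.2.2.1)
    omega
  rw [← h.2.2.1, ← h'.2.2.1, le_antisymm (key h h') (key h' h)]

/-! ### Counting tight right extensions -/

/-- The largest related position contributes one value; by `htri`, all smaller positions share a
single further value. -/
theorem exists_cover_two {β : Type*} (R : ℕ → β → Prop) (N : ℕ) (hN : ∀ d u, R d u → d ≤ N)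
    (hfun : ∀ d u u', R d u → R d u' → u = u')
    (htri : ∀ d₁ d₂ d₃ u₁ u₂ u₃, d₁ < d₂ → d₂ < d₃ → R d₁ u₁ → R d₂ u₂ → R d₃ u₃ → u₁ = u₂) :
    ∃ F : Finset β, F.card ≤ 2 ∧ ∀ d u, R d u → u ∈ F := by
  classical
  by_cases h : ∃ d u, R d u
  · obtain ⟨d₀, u₀, h₀⟩ := h
    set D := Nat.findGreatest (fun d => ∃ u, R d u) N
    have hD : ∃ u, R D u :=
      Nat.findGreatest_spec (P := fun d => ∃ u, R d u) (hN _ _ h₀) ⟨u₀, h₀⟩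
    obtain ⟨U, hU⟩ := hD
    have hle : ∀ d u, R d u → d ≤ D := fun d u hd => Nat.le_findGreatest (hN _ _ hd) ⟨u, hd⟩
    by_cases h2 : ∃ d u, d < D ∧ R d u
    · obtain ⟨d', u', hlt, h'⟩ := h2
      refine ⟨{U, u'}, Finset.card_le_two, fun d u hd => ?_⟩
      rw [Finset.mem_insert, Finset.mem_singleton]
      rcases (hle d u hd).eq_or_lt with rfl | hdD
      · exact Or.inl (hfun _ _ _ hd hU)
      · right
        rcases Nat.lt_trichotomy d d' with hh | rfl | hh
        · exact htri _ _ _ _ _ _ hh hlt hd h' hU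
        · exact hfun _ _ _ hd h'
        · exact (htri _ _ _ _ _ _ hh hdD h' hd hU).symm
    · refine ⟨{U}, by simp, fun d u hd => ?_⟩
      rw [Finset.mem_singleton]
      rcases (hle d u hd).eq_or_lt with rfl | hdD
      · exact hfun _ _ _ hd hU
      · exact absurd ⟨d, u, hdD, hd⟩ h2
  · exact ⟨∅, by simp, fun d u hd => absurd ⟨d, u, hd⟩ h⟩

/-- At most three tight right extensions of `w` have an occurrence across a given position. -/
theorem exists_cover_across (L w : List α) (e : ℕ) {θ : ℕ} (hw : 3 * θ ≤ cost w) :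
    ∃ F : Finset (List α), F.card ≤ 3 ∧ ∀ d u, ExtendsAt L w θ d u → d < e + w.length →
      e < d + u.length → u ∈ F := by
  classical
  -- Case `e ≤ d < e + w.length`. Three such ends lie so close that the copies of `w` overlap, and
  -- the text after `d₁` begins with a copy of the block from `d₂` to `d₃`. That block costs at
  -- least `θ`, so the tight words after `d₁` and `d₂` are both prefixes of it and coincide.
  obtain ⟨F, hF, hF'⟩ := exists_cover_two
    (fun d u => ExtendsAt L w θ d u ∧ e ≤ d ∧ d < e + w.length) L.length
    (fun d u h => by have := h.1.2.1; omega) (fun d u u' h h' => h.1.eq h'.1) (by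
      rintro d₁ d₂ d₃ u₁ u₂ u₃ h12 h23 ⟨h₁, he₁, -⟩ ⟨h₂, -, -⟩ ⟨h₃, -, hd₃⟩
      have hL : d₃ ≤ L.length := by have := h₃.2.1; omega
      have hc : θ ≤ blockCost L d₂ d₃ := by
        have := h₂.1.cost_le h₃.1 h23 hL
        omega
      have hw1 := h₁.1.1
      have hper : ∀ t, d₁ ≤ t → t < d₁ + (d₃ - d₂) → L[t]? = L[t + (d₂ - d₁)]? := by
        intro t ht1 ht2
        have a1 := h₁.1.getElem?_eq h₂.1 h12.le (i := t - (d₃ - d₂)) (by omega) (by omega)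
        have a2 := h₂.1.getElem?_eq h₃.1 h23.le (i := t - (d₃ - d₂)) (by omega) (by omega)
        have a3 := h₂.1.getElem?_eq h₃.1 h23.le (i := t - (d₃ - d₂) + (d₂ - d₁))
          (by omega) (by omega)
        rw [show t - (d₃ - d₂) + (d₃ - d₂) = t by have := h₁.1.1; omega] at a2
        rw [show t - (d₃ - d₂) + (d₂ - d₁) + (d₃ - d₂) = t + (d₂ - d₁) by
          have := h₁.1.1; omega] at a3
        rw [← a2, a1, a3]
      have hblock : block L d₁ (d₁ + (d₃ - d₂)) = block L d₂ d₃ := by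
        apply List.ext_getElem?
        intro i
        simp only [getElem?_block]
        split_ifs with hh1 hh2
        · rw [hper _ (by omega) (by omega)]
          congr 1; omega
        · omega
        · omega
        · rfl
      have hc' : θ ≤ blockCost L d₁ (d₁ + (d₃ - d₂)) := by
        rw [blockCost, hblock]; exact hc
      have hl₁ := h₁.2.2.2.length_le h₁.2.2.1 (Nat.le_add_right _ _) hc'
      have hl₂ := h₂.2.2.2.length_le h₂.2.2.1 h23.le hc
      have hext : ExtendsAt L w θ d₂ u₁ := by
        refine ⟨h₂.1, by omega, ?_, h₁.2.2.2⟩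
        have := congrArg (List.take u₁.length) hblock
        rw [take_block L (by omega), take_block L (by omega), h₁.2.2.1] at this
        exact this.symm
      exact hext.eq h₂)
  -- Case `d < e`. If `w` ended again at `d'` with `d < d' < e`, the block between would cost at
  -- least `θ`, so the tight word after `d` would stop by `d'` and not reach across `e`.
  obtain ⟨x, hx⟩ : ∃ x, ∀ d u, ExtendsAt L w θ d u → d < e → e < d + u.length → u = x := by
    by_cases h : ∃ d u, ExtendsAt L w θ d u ∧ d < e ∧ e < d + u.length
    · obtain ⟨d₀, u₀, h₀, hd₀, he₀⟩ := h
      refine ⟨u₀, fun d u hd hde hed => ?_⟩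
      have key : ∀ {d d' u u'}, ExtendsAt L w θ d u → ExtendsAt L w θ d' u' → d < d' → d' < e →
          e < d + u.length → False := by
        intro d d' u u' h h' hdd hd' he
        have h1 := h.1.cost_le h'.1 hdd (by have := h'.2.1; omega)
        have h2 : θ ≤ blockCost L d d' := by omega
        have := h.2.2.2.length_le h.2.2.1 hdd.le h2
        omega
      rcases Nat.lt_trichotomy d d₀ with hh | rfl | hh
      · exact (key hd h₀ hh hd₀ hed).elim
      · exact hd.eq h₀
      · exact (key h₀ hd hh hde he₀).elim
    · exact ⟨[], fun d u h1 h2 h3 => absurd ⟨d, u, h1, h2, h3⟩ h⟩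
  refine ⟨insert x F, (Finset.card_insert_le _ _).trans (by omega), fun d u h h1 h2 => ?_⟩
  rw [Finset.mem_insert]
  rcases lt_or_ge d e with hd | hd
  · exact Or.inl (hx d u h hd h2)
  · exact Or.inr (hF' d u ⟨h, hd, h1⟩)

theorem extendsAt_of_block {L w u : List α} {θ s : ℕ} (hu : Tight θ u)
    (hs : s + (w ++ u).length ≤ L.length) (hb : block L s (s + (w ++ u).length) = w ++ u) :
    ExtendsAt L w θ (s + w.length) u := by
  rw [List.length_append] at hs hb
  refine ⟨⟨by omega, ?_⟩, by omega, ?_, hu⟩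
  · have := congrArg (List.take w.length) hb
    rw [take_block L (by omega), List.take_left] at this
    rw [Nat.add_sub_cancel]
    exact this
  · have h1 : block L s (s + w.length) = w := by
      have := congrArg (List.take w.length) hb
      rwa [take_block L (by omega), List.take_left] at this
    have h2 := block_append (W := L) (a := s) (b := s + w.length) (c := s + (w.length + u.length))
      (by omega) (by omega) (by omega)
    rw [hb, h1] at h2
    rw [add_assoc]
    exact List.append_cancel_left h2

theorem block_append_left {A B : List α} {a b : ℕ} (h : b ≤ A.length) :
    block (A ++ B) a b = block A a b := by
  apply List.ext_getElem?
  intro i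
  simp only [getElem?_block]
  split_ifs
  · rw [List.getElem?_append_left (by omega)]
  · rfl

theorem block_append_right {A B : List α} {a b : ℕ} (h : A.length ≤ a) :
    block (A ++ B) a b = block B (a - A.length) (b - A.length) := by
  apply List.ext_getElem?
  intro i
  simp only [getElem?_block]
  split_ifs <;> first | rfl | (exfalso; omega) | skip
  rw [List.getElem?_append_right (by omega)]
  congr 1; omega

theorem exists_cover_append (A B w : List α) {θ : ℕ} (hw : 3 * θ ≤ cost w) :
    ∃ F : Finset (List α), F.card ≤ 3 ∧ ∀ u, Tight θ u → w ++ u <:+: A ++ B →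
      w ++ u <:+: A ∨ w ++ u <:+: B ∨ u ∈ F := by
  obtain ⟨F, hF, hF'⟩ := exists_cover_across (A ++ B) w A.length hw
  refine ⟨F, hF, fun u hu hinf => ?_⟩
  obtain ⟨s, hs, hb⟩ := infix_iff_block.1 hinf
  rcases le_or_gt (s + (w ++ u).length) A.length with h1 | h1
  · left
    rw [block_append_left h1] at hb
    rw [← hb]
    exact block_infix _ _ _
  rcases le_or_gt A.length s with h2 | h2
  · right; left
    rw [block_append_right h2] at hb
    rw [← hb]
    exact block_infix _ _ _
  · right; right
    rw [List.length_append] at h1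
    exact hF' _ _ (extendsAt_of_block hu hs hb) (by omega) (by omega)

/-- By periodicity an occurrence can be shifted to start within the first copy of `v` in a long run
`L`; it then lies inside that copy or crosses its right end. -/
theorem exists_cover_run {v A : List α} (hA : IsRunOf v A) (w : List α) {θ : ℕ}
    (hw : 3 * θ ≤ cost w) :
    ∃ F : Finset (List α), F.card ≤ 3 ∧ ∀ u, Tight θ u → w ++ u <:+: A →
      w ++ u <:+: v ∨ u ∈ F := by
  have hv : 0 < v.length := List.length_pos_iff.2 hA.1
  set L : List α := (List.range (v.length + A.length)).map
    fun i => v[i % v.length]'(Nat.mod_lt _ hv) with hL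
  have hLlen : L.length = v.length + A.length := by simp [hL]
  have hLget : ∀ i, i < v.length + A.length → L[i]? = v[i % v.length]? := by
    intro i hi
    simp [hL, hi, Nat.mod_lt _ hv]
  obtain ⟨F, hF, hF'⟩ := exists_cover_across L w v.length hw
  refine ⟨F, hF, fun u hu hinf => ?_⟩
  have hlen := hinf.length_le
  obtain ⟨-, s, hs⟩ := hA.infix hinf
  have hsv := Nat.mod_lt s hv
  have hb : block L (s % v.length) (s % v.length + (w ++ u).length) = w ++ u := by
    apply List.ext_getElem?
    intro i
    rw [getElem?_block]
    split_ifs with h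
    · rw [hLget _ (by omega), hs i (by omega), Nat.mod_add_mod]
    · rw [List.getElem?_eq_none (by omega)]
  rcases le_or_gt (s % v.length + (w ++ u).length) v.length with h1 | h1
  · left
    have : block L (s % v.length) (s % v.length + (w ++ u).length)
        = block v (s % v.length) (s % v.length + (w ++ u).length) := by
      apply List.ext_getElem?
      intro i
      simp only [getElem?_block]
      split_ifs
      · rw [hLget _ (by omega), Nat.mod_eq_of_lt (by omega : s % v.length + i < v.length)]
      · rfl
    rw [← hb, this]
    exact block_infix _ _ _
  · right
    have hh := extendsAt_of_block hu (by omega) hb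
    rw [List.length_append] at h1
    exact hF' _ _ hh (by omega) (by omega)

/-- A word can be split at a letter or a run where the accumulated cost exceeds `t`. -/
theorem HasCost.exists_split {h : ℕ} {W : List α} (hW : HasCost h W) (t : ℕ) :
    ∃ (w₁ A w₂ : List α) (h₁ hA h₂ : ℕ), W = w₁ ++ (A ++ w₂) ∧ HasCost h₁ w₁ ∧ HasCost hA A ∧
      HasCost h₂ w₂ ∧ h₁ + hA + h₂ ≤ h ∧ h₁ ≤ t ∧ (t < h₁ + hA ∨ w₂ = []) ∧
      (A.length ≤ 1 ∨ ∃ a v, HasCost a v ∧ IsRunOf v A ∧ 3 * a = hA) := by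
  induction hW generalizing t with
  | nil => exact ⟨[], [], [], 0, 0, 0, rfl, .nil, .nil, .nil, by simp, by simp, by simp, by simp⟩
  | letter a =>
    exact ⟨[], [a], [], 0, 1, 0, rfl, .nil, .letter a, .nil, by simp, by simp, by simp, by simp⟩
  | @append a b p q hp hq ihp ihq =>
    obtain ⟨w₁, A, w₂, h₁, hA, h₂, rfl, c1, cA, c2, hle, hlt, hor, hat⟩ := ihp t
    rcases lt_or_ge t (h₁ + hA) with hh | hh
    · exact ⟨w₁, A, w₂ ++ q, h₁, hA, h₂ + b, by simp, c1, cA, c2.append hq, by omega, hlt,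
        Or.inl hh, hat⟩
    · obtain rfl : w₂ = [] := hor.resolve_left (by omega)
      obtain ⟨x₁, A', x₂, g₁, gA, g₂, rfl, d1, dA, d2, gle, glt, gor, gat⟩ :=
        ihq (t - (h₁ + hA))
      refine ⟨w₁ ++ A ++ x₁, A', x₂, h₁ + hA + g₁, gA, g₂, by simp, (c1.append cA).append d1, dA,
        d2, by omega, by omega, ?_, gat⟩
      rcases gor with gor | gor
      · left; omega
      · exact Or.inr gor
  | @run a v w hv hr _ =>
    exact ⟨[], w, [], 0, 3 * a, 0, by simp, .nil, .run hv hr, .nil, by simp, by simp, by simp,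
      Or.inr ⟨a, v, hv, hr, rfl⟩⟩

/-- The number of tight right extensions of a word `w` inside a word `W` is bounded in terms of
the ratio of the costs of `W` and `w`. -/
theorem exists_cover_extensions {κ θ : ℕ} (hκ : 0 < κ) {w : List α}
    (hwκ : 3 * κ ≤ cost w) (hwθ : 3 * θ ≤ cost w) (m : ℕ) :
    ∀ {h : ℕ} {W : List α}, HasCost h W → h ≤ m * κ →
      ∃ F : Finset (List α), F.card + 9 ≤ 9 * 2 ^ m ∧
        ∀ u, Tight θ u → w ++ u <:+: W → u ∈ F := by
  classical
  have small : ∀ {h : ℕ} {W : List α}, HasCost h W → h < 3 * κ → ∀ u, ¬ w ++ u <:+: W := by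
    intro h W hW hlt u hu
    have h1 := cost_mono (List.infix_append_left.trans hu : w <:+: W)
    have h2 := hW.cost_le
    omega
  induction m with
  | zero =>
    intro h W hW hle
    exact ⟨∅, by simp, fun u _ hu => absurd hu (small hW (by omega) u)⟩
  | succ m ih =>
    intro h W hW hle
    have hpow : 1 ≤ 2 ^ m := Nat.one_le_two_pow
    rw [Nat.succ_mul] at hle
    rcases lt_or_ge h (3 * κ) with hh | hh
    · refine ⟨∅, ?_, fun u _ hu => absurd hu (small hW hh u)⟩
      rw [Finset.card_empty, pow_succ]; omega
    -- The threshold leaves `w₁` too cheap to contain `w`, while `w₂` is empty or has lost at least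
    -- `3 * κ` of the budget. If `A` is a run, its root has at most a third of the cost. Both fall
    -- under the induction hypothesis; the two cuts and the run add three words each, whence the `+
    -- 9`.
    obtain ⟨w₁, A, w₂, h₁, hA, h₂, rfl, c1, cA, c2, hle', hlt, hor, hat⟩ :=
      hW.exists_split (3 * κ - 1)
    obtain ⟨F₁, hF₁, hF₁'⟩ := exists_cover_append w₁ (A ++ w₂) w hwθ
    obtain ⟨F₂, hF₂, hF₂'⟩ := exists_cover_append A w₂ w hwθ
    obtain ⟨G₂, hG₂, hG₂'⟩ : ∃ F : Finset (List α), F.card + 9 ≤ 9 * 2 ^ m ∧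
        ∀ u, Tight θ u → w ++ u <:+: w₂ → u ∈ F := by
      rcases hor with hor | hor
      · exact ih c2 (by omega)
      · refine ⟨∅, by rw [Finset.card_empty]; omega, fun u _ hu => ?_⟩
        subst hor
        exact absurd hu (small .nil (by omega) u)
    obtain ⟨G₁, hG₁, hG₁'⟩ : ∃ F : Finset (List α), F.card + 9 ≤ 9 * 2 ^ m + 3 ∧
        ∀ u, Tight θ u → w ++ u <:+: A → u ∈ F := by
      rcases hat with hat | ⟨a, v, hv, hr, ha⟩
      · refine ⟨∅, by rw [Finset.card_empty]; omega, fun u _ hu => ?_⟩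
        have h1 := cost_mono (List.infix_append_left.trans hu : w <:+: A)
        have h2 := cost_le_one hat
        omega
      · obtain ⟨F, hF, hF'⟩ := exists_cover_run hr w hwθ
        obtain ⟨G, hG, hG'⟩ := ih hv (by omega)
        refine ⟨F ∪ G, ?_, fun u hu hinf => ?_⟩
        · have := Finset.card_union_le F G
          omega
        · rw [Finset.mem_union]
          rcases hF' u hu hinf with h | h
          · exact Or.inr (hG' u hu h)
          · exact Or.inl h
    refine ⟨(F₁ ∪ F₂) ∪ (G₁ ∪ G₂), ?_, fun u hu hinf => ?_⟩
    · have i1 := Finset.card_union_le (F₁ ∪ F₂) (G₁ ∪ G₂)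
      have i2 := Finset.card_union_le F₁ F₂
      have i3 := Finset.card_union_le G₁ G₂
      rw [pow_succ]
      omega
    · simp only [Finset.mem_union]
      rcases hF₁' u hu hinf with h | h | h
      · exact absurd h (small c1 (by omega) u)
      · rcases hF₂' u hu h with h | h | h
        · exact Or.inr (Or.inl (hG₁' u hu h))
        · exact Or.inr (Or.inr (hG₂' u hu h))
        · exact Or.inl (Or.inr h)
      · exact Or.inl (Or.inl h)

/-! ### Reflection in palindromes and removal of cheap prefixes -/

theorem block_reverse {W : List α} {c d a b : ℕ} (hd : d ≤ W.length)
    (hpal : (block W c d).reverse = block W c d) (hca : c ≤ a) (hab : a ≤ b) (hbd : b ≤ d) :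
    block W (c + d - b) (c + d - a) = (block W a b).reverse := by
  have hget : ∀ i, c ≤ i → i < d → W[i]? = W[c + d - 1 - i]? := by
    intro i hi hid
    have h := congrArg (fun z => z[i - c]?) hpal
    have hlen : (block W c d).length = d - c := length_block_of_le hd
    rw [List.getElem?_reverse (by omega), getElem?_block, getElem?_block, if_pos (by omega),
      if_pos (by omega), hlen] at h
    rw [show i = c + (i - c) by omega, ← h]
    congr 1; omega
  have hlen : (block W a b).length = b - a := length_block_of_le (hbd.trans hd)
  apply List.ext_getElem?
  intro i
  rw [getElem?_block]
  split_ifs with h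
  · rw [List.getElem?_reverse (by omega), getElem?_block, if_pos (by omega),
      hget _ (by omega) (by omega), hlen]
    congr 1; omega
  · rw [List.getElem?_eq_none]
    rw [List.length_reverse]; omega

theorem blockCost_reflect {W : List α} {c d a b : ℕ} (hd : d ≤ W.length)
    (hpal : (block W c d).reverse = block W c d) (hca : c ≤ a) (hab : a ≤ b) (hbd : b ≤ d) :
    blockCost W (c + d - b) (c + d - a) = blockCost W a b := by
  rw [blockCost, block_reverse hd hpal hca hab hbd, cost_reverse, blockCost]

/-- Remove from `u` its longest prefix of cost at most `t`. -/
noncomputable def dropCost (t : ℕ) (u : List α) : List α :=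
  by classical exact u.drop (Nat.findGreatest (fun n => cost (u.take n) ≤ t) u.length)

theorem dropCost_spec (t : ℕ) (u : List α) :
    ∃ n ≤ u.length, dropCost t u = u.drop n ∧ cost (u.take n) ≤ t ∧
      ∀ n' ≤ u.length, cost (u.take n') ≤ t → n' ≤ n := by
  classical
  refine ⟨Nat.findGreatest (fun n => cost (u.take n) ≤ t) u.length, Nat.findGreatest_le _, ?_,
    ?_, fun n' hn' h => Nat.le_findGreatest hn' h⟩
  · unfold dropCost
    congr
  · exact Nat.findGreatest_spec (P := fun n => cost (u.take n) ≤ t) (Nat.zero_le _)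
      (by simp [cost_nil])

theorem cost_dropCost_le (t : ℕ) (u : List α) : cost (dropCost t u) ≤ cost u := by
  obtain ⟨n, -, h, -⟩ := dropCost_spec t u
  rw [h]
  exact cost_mono (List.drop_suffix _ _).isInfix

theorem le_cost_dropCost (t : ℕ) (u : List α) : cost u ≤ t + cost (dropCost t u) := by
  obtain ⟨n, -, h, h1, -⟩ := dropCost_spec t u
  have := cost_append_le (u.take n) (u.drop n)
  rw [List.take_append_drop] at this
  rw [h]
  omega

/-- The word `u` occurs in `W` at the position `a`. -/
def OccursAt (W u : List α) (a : ℕ) : Prop :=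
  a + u.length ≤ W.length ∧ block W a (a + u.length) = u

/-- Maximality of the removed prefix pushes the occurrence past `d`. The remaining word depends only
on `t` and `u`, not on `d`, which keeps the set of words finite and small. -/
theorem OccursAt.dropCost {W u : List α} {a d t : ℕ} (h : OccursAt W u a)
    (hd : blockCost W a d ≤ t) (ht : t < cost u) (had : a ≤ d) :
    ∃ a', d ≤ a' ∧ blockCost W a a' ≤ t ∧ OccursAt W (dropCost t u) a' := by
  obtain ⟨n, hn, he, h1, h2⟩ := dropCost_spec t u
  have hdu : d ≤ a + u.length := by
    by_contra! hlt
    have := blockCost_mono W (le_refl a) hlt.le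
    have h3 : blockCost W a (a + u.length) = cost u := by rw [blockCost, h.2]
    omega
  have htake : ∀ n ≤ u.length, block W a (a + n) = u.take n := by
    intro n hn
    rw [← take_block W (b := a + u.length) (by omega), h.2]
  refine ⟨a + n, ?_, ?_, ?_⟩
  · have := h2 (d - a) (by omega) (by
      rw [← htake _ (by omega), Nat.add_sub_cancel' had]; exact hd)
    omega
  · rw [blockCost, htake n hn]; exact h1
  · rw [he]
    have hl := h.1
    refine ⟨by rw [List.length_drop]; omega, ?_⟩
    have h3 := block_append (W := W) (a := a) (b := a + n) (c := a + u.length) (by omega)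
      (by omega) hl
    rw [h.2, htake n hn] at h3
    rw [List.length_drop, show a + n + (u.length - n) = a + u.length by omega]
    conv_rhs at h3 => rw [← List.take_append_drop n u]
    exact List.append_cancel_left h3

/-! ### Endpoints of palindromic paths -/

/-- `[c, d)` is a possibly empty palindromic block of `W` whose cost is at most `lo` or at
least `hi`. -/
def PalStep (W : List α) (lo hi c d : ℕ) : Prop :=
  c ≤ d ∧ d ≤ W.length ∧ (block W c d).reverse = block W c d ∧
    (blockCost W c d ≤ lo ∨ hi ≤ blockCost W c d)

/-- Up to cost `r`, a reversed word from `U` ends just before the position `c`. -/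
def NearEnd (W : List α) (U : Finset (List α)) (r c : ℕ) : Prop :=
  ∃ b ≤ c, blockCost W b c ≤ r ∧ (b = 0 ∨ ∃ u ∈ U, EndsAt W u.reverse b)

/-- Up to cost `r`, a word from `U` occurs just after the position `c`, unless the rest of `W`
costs less than `hi`. -/
def NearOcc (W : List α) (U : Finset (List α)) (hi r c : ℕ) : Prop :=
  hi ≤ blockCost W c W.length → ∃ a, c ≤ a ∧ blockCost W c a ≤ r ∧ ∃ u ∈ U, OccursAt W u a

/-- A cheap palindrome costs at most `lo` of extra distance; a word starting before `d` is
truncated. An expensive one reflects the occurrence of `u` near `c` to `u.reverse` ending near `d`,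
and the word following near `d` is a truncated tight extension of `u.reverse`, for which there are
few choices. If the rest of `W` costs less than `hi`, no expensive palindrome can follow, so
`NearOcc` need not supply a word. -/
theorem exists_words_step {W : List α} {κ m θ Θ lo hi r : ℕ} (hκ : 0 < κ) (hW : cost W ≤ m * κ)
    (hκθ : 3 * κ ≤ 6 * θ) (hrθ : r + lo ≤ θ) (hhi : Θ + 2 * r < hi) (hθhi : 2 * θ ≤ hi)
    {U : Finset (List α)} (hU : ∀ u ∈ U, 6 * θ ≤ cost u ∧ cost u ≤ Θ) :
    ∃ U' : Finset (List α), U'.card ≤ (2 + 9 * 2 ^ m) * U.card ∧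
      (∀ u ∈ U', θ ≤ cost u ∧ cost u ≤ Θ) ∧
      ∀ c d, PalStep W lo hi c d → NearEnd W U r c → NearOcc W U hi r c →
        NearEnd W U' (r + lo) d ∧ NearOcc W U' hi (r + lo) d := by
  classical
  have hθ0 : 0 < θ := by omega
  have hF : ∀ u ∈ U, ∃ F : Finset (List α), F.card ≤ 9 * 2 ^ m ∧
      ∀ u', Tight (2 * θ) u' → u.reverse ++ u' <:+: W → u' ∈ F := by
    intro u hu
    have h1 := (hU u hu).1
    obtain ⟨F, h2, h3⟩ := exists_cover_extensions hκ (θ := 2 * θ) (w := u.reverse)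
      (by rw [cost_reverse]; omega) (by rw [cost_reverse]; omega) m (hasCost_cost W) hW
    exact ⟨F, by omega, h3⟩
  choose! F hFcard hF using hF
  set E : Finset (List α) := (U.biUnion F).filter (Tight (2 * θ)) with hE
  have hEcard : E.card ≤ U.card * (9 * 2 ^ m) :=
    (Finset.card_filter_le _ _).trans (Finset.card_biUnion_le_card_mul _ _ _ hFcard)
  -- `U` itself serves the reflected ends, the truncations serve the next occurrences. Tight words
  -- of cost `2 * θ` keep cost at least `θ` since `r + lo ≤ θ`.
  refine ⟨U ∪ (U ∪ E).image (dropCost (r + lo)), ?_, ?_, ?_⟩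
  · have h1 := Finset.card_union_le U ((U ∪ E).image (dropCost (r + lo)))
    have h2 : ((U ∪ E).image (dropCost (r + lo))).card ≤ (U ∪ E).card := Finset.card_image_le
    have h3 := Finset.card_union_le U E
    rw [Nat.add_mul, Nat.mul_comm (9 * 2 ^ m)]
    omega
  · intro u hu
    rw [Finset.mem_union, Finset.mem_image] at hu
    rcases hu with hu | ⟨v, hv, rfl⟩
    · have := hU u hu
      omega
    · have h1 := le_cost_dropCost (r + lo) v
      have h2 := cost_dropCost_le (r + lo) v
      rw [Finset.mem_union] at hv
      rcases hv with hv | hv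
      · have := hU v hv
        omega
      · rw [hE, Finset.mem_filter, Finset.mem_biUnion] at hv
        obtain ⟨⟨u, hu, -⟩, hv⟩ := hv
        have h3 := hv.cost_eq (by omega)
        have := hU u hu
        omega
  · rintro c d ⟨hcd, hd, hpal, hlen⟩ hnear hocc
    have hsub : U ⊆ U ∪ (U ∪ E).image (dropCost (r + lo)) := Finset.subset_union_left
    have hdrop : ∀ v, v ∈ U ∪ E →
        dropCost (r + lo) v ∈ U ∪ (U ∪ E).image (dropCost (r + lo)) := fun v hv =>
      Finset.mem_union_right _ (Finset.mem_image_of_mem _ hv)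
    rcases hlen with hlen | hlen
    · constructor
      · obtain ⟨b, hb, hbr, hor⟩ := hnear
        refine ⟨b, hb.trans hcd, ?_, hor.imp id fun ⟨u, hu, h⟩ => ⟨u, hsub hu, h⟩⟩
        have := blockCost_add hb hcd hd
        omega
      · intro hh
        obtain ⟨a, hca, har, u, hu, hua⟩ := hocc (hh.trans (blockCost_mono W hcd le_rfl))
        rcases le_or_gt d a with hda | hda
        · exact ⟨a, hda, (blockCost_mono W hcd le_rfl).trans (har.trans (Nat.le_add_right _ _)),
            u, hsub hu, hua⟩
        · have h1 := blockCost_mono W hca (le_refl d)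
          have h2 := (hU u hu).1
          obtain ⟨a', hda', ha', hocc'⟩ := hua.dropCost (t := r + lo) (by omega) (by omega) hda.le
          exact ⟨a', hda', (blockCost_mono W hda.le le_rfl).trans ha', _,
            hdrop u (Finset.mem_union_left _ hu), hocc'⟩
    · obtain ⟨a, hca, har, u, hu, hua⟩ := hocc (hlen.trans (blockCost_mono W le_rfl hd))
      have hua1 := hua.1
      have had : a < d := by
        by_contra! h
        have := blockCost_mono W (le_refl c) h
        omega
      -- `b` is the mirror image of `a`. Because `hi > Θ + 2 * r`, the word `u` starting at `a` ends
      -- no later than `b`, hence inside the palindrome.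
      obtain ⟨b, hb⟩ : ∃ b, b = c + d - a := ⟨_, rfl⟩
      have hbd : blockCost W b d = blockCost W c a := by
        have := blockCost_reflect hd hpal le_rfl hca had.le
        rwa [Nat.add_sub_cancel_left, ← hb] at this
      have hsum := blockCost_add hca had.le hd
      have hab : a ≤ b := by
        by_contra! h
        have := blockCost_mono W h.le (le_refl d)
        omega
      have hsum2 := blockCost_add hab (by omega : b ≤ d) hd
      have hcu : blockCost W a (a + u.length) = cost u := by rw [blockCost, hua.2]
      have hUu := hU u hu
      have hub : a + u.length ≤ b := by
        by_contra! h
        have := blockCost_mono W (le_refl a) h.le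
        omega
      have hend : EndsAt W u.reverse b := by
        refine ⟨by rw [List.length_reverse]; omega, ?_⟩
        rw [List.length_reverse]
        have := block_reverse hd hpal hca (Nat.le_add_right a u.length) (by omega)
        rw [hua.2, ← hb] at this
        rw [← this]
        congr 1; omega
      constructor
      · exact ⟨b, by omega, by omega, Or.inr ⟨u, hsub hu, hend⟩⟩
      · intro hh
        have hbW : 2 * θ ≤ blockCost W b W.length :=
          hθhi.trans (hh.trans (blockCost_mono W (by omega) le_rfl))
        obtain ⟨u', hu', hblock, hlen'⟩ := exists_tight (by omega) le_rfl hbW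
        have hmem : u' ∈ E := by
          rw [hE, Finset.mem_filter, Finset.mem_biUnion]
          refine ⟨⟨u, hu, hF u hu u' hu' ?_⟩, hu'⟩
          have h1 := block_append (W := W) (a := b - u.reverse.length) (b := b)
            (c := b + u'.length) (by omega) (by omega) hlen'
          rw [hend.2, hblock] at h1
          rw [h1]
          exact block_infix _ _ _
        have hc' := hu'.cost_eq (by omega)
        obtain ⟨a', hda', ha', hocc'⟩ := OccursAt.dropCost (W := W) (t := r + lo) (d := d)
          ⟨hlen', hblock⟩ (by omega) (by omega) (by omega)
        exact ⟨a', hda', (blockCost_mono W (by omega) le_rfl).trans ha', _,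
          hdrop u' (Finset.mem_union_right _ hmem), hocc'⟩

/-- Few words control the positions that can be reached from the beginning of `W` by `k`
palindromes, none of which has a cost between `lo` and `hi`. -/
theorem exists_words {W : List α} {κ m lo k : ℕ} (hκ : 0 < κ) (hW : cost W ≤ m * κ)
    (hlo : k * lo ≤ 3 * κ) (hcost : 6 ^ k * (3 * κ) ≤ cost W) :
    ∃ U : Finset (List α), U.card ≤ (2 + 9 * 2 ^ m) ^ k ∧ (∀ u ∈ U, 3 * κ ≤ cost u) ∧
      ∀ c : ℕ → ℕ, c 0 = 0 →
        (∀ i < k, PalStep W lo (6 ^ (k + 1) * (3 * κ)) (c i) (c (i + 1))) →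
        NearEnd W U (k * lo) (c k) := by
  have main : ∀ i ≤ k, ∃ U : Finset (List α), U.card ≤ (2 + 9 * 2 ^ m) ^ i ∧
      (∀ u ∈ U, 6 ^ (k - i) * (3 * κ) ≤ cost u ∧ cost u ≤ 6 ^ k * (3 * κ)) ∧
      ∀ c : ℕ → ℕ, c 0 = 0 →
        (∀ j < i, PalStep W lo (6 ^ (k + 1) * (3 * κ)) (c j) (c (j + 1))) →
        NearEnd W U (i * lo) (c i) ∧ NearOcc W U (6 ^ (k + 1) * (3 * κ)) (i * lo) (c i) := by
    intro i
    induction i with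
    | zero =>
      intro _
      rw [← block_self_length W, ← blockCost] at hcost
      -- The only endpoint before any step is `0`, and one tight prefix of `W` describes what
      -- follows it.
      obtain ⟨u, hu, hb, hle⟩ := exists_tight (Nat.zero_le _) le_rfl hcost
      have hc := hu.cost_eq (by positivity)
      refine ⟨{u}, by simp, ?_, ?_⟩
      · intro v hv
        rw [Finset.mem_singleton] at hv
        subst hv
        simp [hc]
      · intro c hc0 _
        rw [hc0]
        refine ⟨⟨0, le_rfl, by simp [blockCost_of_le], Or.inl rfl⟩, fun _ => ?_⟩
        exact ⟨0, le_rfl, by simp [blockCost_of_le], u, by simp, hle, hb⟩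
    | succ i ih =>
      intro hik
      obtain ⟨U, hcard, hU, hc⟩ := ih (by omega)
      have e1 : 6 ^ (k - i) * (3 * κ) = 6 * (6 ^ (k - (i + 1)) * (3 * κ)) := by
        rw [show k - i = k - (i + 1) + 1 by omega, pow_succ]; ring
      have e2 : 6 ^ (k + 1) * (3 * κ) = 6 * (6 ^ k * (3 * κ)) := by rw [pow_succ]; ring
      have e3 : 3 * κ ≤ 6 ^ (k - (i + 1)) * (3 * κ) :=
        Nat.le_mul_of_pos_left _ (by positivity)
      have e4 : 6 ^ (k - (i + 1)) * (3 * κ) ≤ 6 ^ k * (3 * κ) :=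
        Nat.mul_le_mul_right _ (Nat.pow_le_pow_right (by norm_num) (by omega))
      have e5 : i * lo + lo ≤ 3 * κ := by
        rw [← Nat.succ_mul]
        exact (Nat.mul_le_mul_right _ hik).trans hlo
      obtain ⟨U', hcard', hU', hstep⟩ := exists_words_step (r := i * lo) (lo := lo)
        (θ := 6 ^ (k - (i + 1)) * (3 * κ)) (Θ := 6 ^ k * (3 * κ))
        (hi := 6 ^ (k + 1) * (3 * κ)) hκ hW (by omega) (by omega) (by omega)
        (by omega) (U := U) (fun u hu => by rw [← e1]; exact hU u hu)
      refine ⟨U', ?_, hU', fun c hc0 hj => ?_⟩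
      · rw [pow_succ, Nat.mul_comm]
        exact hcard'.trans (Nat.mul_le_mul_left _ hcard)
      · obtain ⟨h1, h2⟩ := hc c hc0 fun j hj' => hj j (by omega)
        rw [Nat.succ_mul]
        exact hstep _ _ (hj i (by omega)) h1 h2
  obtain ⟨U, h1, h2, h3⟩ := main k le_rfl
  refine ⟨U, h1, fun u hu => ?_, fun c hc0 hc => (h3 c hc0 hc).1⟩
  have := (h2 u hu).1
  simpa using this

/-! ### Costly intervals without reachable endpoints -/

/-- An expensive interval contains a subinterval that is far away from the points of a finite
set `D`. -/
theorem exists_subinterval {W : List α} (D : Finset ℕ) (r : ℕ) {s : ℕ} (hs : 0 < s) (n : ℕ)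
    {p q : ℕ} (hq : q ≤ W.length) (hD : (D.filter fun x => p < x ∧ x < q).card ≤ n)
    (hc : (n + 1) * (r + 1 + s) ≤ blockCost W p q) :
    ∃ p' q', p ≤ p' ∧ q' ≤ q ∧ s ≤ blockCost W p' q' ∧
      ∀ j, p' ≤ j → j < q' → ∀ b ∈ D, b ≤ j → r < blockCost W b j := by
  induction n generalizing p with
  | zero =>
    have hle : r + 1 ≤ blockCost W p q := by omega
    obtain ⟨e, heq, he, -⟩ := exists_blockCost_eq hq hle
    have hpe : p < e := by
      by_contra! h
      rw [blockCost_of_le W h] at he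
      omega
    have hadd := blockCost_add hpe.le heq hq
    refine ⟨e, q, hpe.le, le_rfl, by omega, fun j hj hjq b hb hbj => ?_⟩
    rcases le_or_gt b p with hbp | hbp
    · have := blockCost_mono W hbp hj
      omega
    · have : b ∈ D.filter fun x => p < x ∧ x < q := by
        rw [Finset.mem_filter]
        exact ⟨hb, hbp, by omega⟩
      rw [Finset.card_eq_zero.1 (Nat.le_zero.1 hD)] at this
      simp at this
  | succ n ih =>
    have hle : r + 1 + s ≤ blockCost W p q := by rw [Nat.succ_mul] at hc; omega
    -- Cut off a piece of cost `r + 1`, then one of cost `s`. If no point of `D` lies strictly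
    -- between `p` and `f`, the second piece works, as earlier points are separated from it by the
    -- first. Otherwise a point is used up and the search continues from `f`.
    obtain ⟨e, heq, he, -⟩ := exists_blockCost_eq hq (by omega : r + 1 ≤ blockCost W p q)
    have hpe : p < e := by
      by_contra! h
      rw [blockCost_of_le W h] at he
      omega
    have hadd := blockCost_add hpe.le heq hq
    obtain ⟨f, hfq, hf, -⟩ := exists_blockCost_eq hq (by omega : s ≤ blockCost W e q)
    have hef : e < f := by
      by_contra! h
      rw [blockCost_of_le W h] at hf
      omega
    by_cases hex : ∃ b ∈ D, p < b ∧ b < f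
    · obtain ⟨b, hb, hpb, hbf⟩ := hex
      have hadd' := blockCost_add (hpe.le.trans hef.le) hfq hq
      have hadd'' := blockCost_add hpe.le hef.le (hfq.trans hq)
      rw [Nat.succ_mul] at hc
      obtain ⟨p', q', h1, h2, h3, h4⟩ := ih (p := f) (by
        have hlt : (D.filter fun x => f < x ∧ x < q).card
            < (D.filter fun x => p < x ∧ x < q).card := by
          apply Finset.card_lt_card
          rw [Finset.ssubset_iff_of_subset]
          · refine ⟨b, ?_, ?_⟩
            · rw [Finset.mem_filter]; exact ⟨hb, hpb, by omega⟩
            · rw [Finset.mem_filter]; omega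
          · intro x hx
            rw [Finset.mem_filter] at hx ⊢
            exact ⟨hx.1, by omega, hx.2.2⟩
        omega) (by omega)
      exact ⟨p', q', by omega, h2, h3, h4⟩
    · refine ⟨e, f, hpe.le, hfq, hf.ge, fun j hj hjf b hb hbj => ?_⟩
      rcases le_or_gt b p with hbp | hbp
      · have := blockCost_mono W hbp hj
        omega
      · exact absurd ⟨b, hb, hbp, by omega⟩ hex

/-- Two ends of the same reversed word inside the interval would bound its cost by three times a
cost below `κ`, against `hU`. So each word of `U` contributes at most one point to avoid. -/
theorem exists_not_nearEnd {W : List α} {κ r s p q : ℕ} {U : Finset (List α)}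
    (hU : ∀ u ∈ U, 3 * κ ≤ cost u) (hs : 0 < s) (hq : q ≤ W.length) (hκ : blockCost W p q < κ)
    (hc : (U.card + 1) * (r + 1 + s) ≤ blockCost W p q) :
    ∃ p' q', p ≤ p' ∧ q' ≤ q ∧ s ≤ blockCost W p' q' ∧
      ∀ j, p' ≤ j → j < q' → ¬ NearEnd W U r j := by
  classical
  set D : Finset ℕ := (Finset.range (W.length + 1)).filter
    fun d => d = 0 ∨ ∃ u ∈ U, EndsAt W u.reverse d with hD
  have hcard : (D.filter fun x => p < x ∧ x < q).card ≤ U.card := by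
    have hex : ∀ d ∈ D.filter (fun x => p < x ∧ x < q), ∃ u ∈ U, EndsAt W u.reverse d := by
      intro d hd
      rw [Finset.mem_filter, hD, Finset.mem_filter] at hd
      exact hd.1.2.resolve_left (by omega)
    choose! g hg hg' using hex
    apply Finset.card_le_card_of_injOn g hg
    have key : ∀ d ∈ D.filter (fun x => p < x ∧ x < q),
        ∀ d' ∈ D.filter (fun x => p < x ∧ x < q), g d = g d' → ¬ d < d' := by
      intro d hd d' hd' he hlt
      have h1 := hg' d hd
      have h2 := hg' d' hd'
      rw [← he] at h2
      have h3 := hU _ (hg d hd)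
      rw [Finset.mem_filter] at hd hd'
      have h4 := h1.cost_le h2 hlt (by omega)
      rw [cost_reverse] at h4
      have h5 := blockCost_mono W hd.2.1.le hd'.2.2.le
      omega
    intro d hd d' hd' he
    have h1 := key d hd d' hd' he
    have h2 := key d' hd' d hd he.symm
    omega
  obtain ⟨p', q', h1, h2, h3, h4⟩ := exists_subinterval D r hs U.card hq hcard hc
  refine ⟨p', q', h1, h2, h3, fun j hj hjq hnear => ?_⟩
  obtain ⟨b, hb, hbr, hor⟩ := hnear
  have := h4 j hj hjq b (by
    rw [hD, Finset.mem_filter, Finset.mem_range]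
    exact ⟨by omega, hor⟩) hb
  omega

/-- `c 0 = 0, c 1, …, c k = j` are the borders of consecutive palindromic blocks of `W`, none of
which has a cost strictly between `lo` and `hi`. -/
def PalPath (W : List α) (lo hi k j : ℕ) (c : ℕ → ℕ) : Prop :=
  c 0 = 0 ∧ c k = j ∧ ∀ i < k, PalStep W lo hi (c i) (c (i + 1))

theorem exists_not_palPath {W : List α} {κ m lo k s p q : ℕ} (hκ : 0 < κ)
    (hW : cost W ≤ m * κ) (hlo : k * lo ≤ 3 * κ) (hcost : 6 ^ (k + 1) * (3 * κ) ≤ cost W)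
    (hs : 0 < s) (hsκ : ((2 + 9 * 2 ^ m) ^ k + 1) * (k * lo + 1 + s) < κ) (hq : q ≤ W.length)
    (hc : ((2 + 9 * 2 ^ m) ^ k + 1) * (k * lo + 1 + s) ≤ blockCost W p q) :
    ∃ p' q', p ≤ p' ∧ q' ≤ q ∧ s ≤ blockCost W p' q' ∧
      ∀ j, p' ≤ j → j < q' → ∀ c, ¬ PalPath W lo (6 ^ (k + 1) * (3 * κ)) k j c := by
  obtain ⟨e, heq, he, -⟩ := exists_blockCost_eq hq hc
  obtain ⟨U, hUcard, hU, hpath⟩ := exists_words (k := k) hκ hW hlo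
    ((Nat.mul_le_mul_right _ (Nat.pow_le_pow_right (by norm_num) (Nat.le_succ k))).trans hcost)
  obtain ⟨p', q', h1, h2, h3, h4⟩ := exists_not_nearEnd (r := k * lo) hU hs (heq.trans hq)
    (he.trans_lt hsκ) (by rw [he]; exact Nat.mul_le_mul_right _ (by omega))
  refine ⟨p', q', h1, h2.trans heq, h3, fun j hj hjq c ⟨c0, ck, hstep⟩ => ?_⟩
  have := hpath c c0 hstep
  rw [ck] at this
  exact h4 j hj hjq this

/-! ### Nested scales and the pigeonhole argument -/

/-- The ratio of consecutive scales may depend on how far the coarser one lies below `τ 0`. There is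
no circularity: the quotients `N` are built from the top by `N (g + 1) = N g * f (N g)`, and `τ` is
then the product of the remaining ratios. -/
theorem exists_scales (f : ℕ → ℕ) (hf : ∀ N, 0 < f N) (n : ℕ) :
    ∃ N τ : ℕ → ℕ, (∀ g, 0 < τ g) ∧ (∀ g < n, τ g = f (N g) * τ (g + 1)) ∧
      ∀ g ≤ n, N g * τ g = τ 0 := by
  set N : ℕ → ℕ := fun g => Nat.rec 1 (fun _ x => x * f x) g with hN
  have hτ : ∀ g < n, ∏ i ∈ Finset.Ico g n, f (N i) =
      f (N g) * ∏ i ∈ Finset.Ico (g + 1) n, f (N i) := fun g hg =>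
    Finset.prod_eq_prod_Ico_succ_bot hg _
  refine ⟨N, fun g => ∏ i ∈ Finset.Ico g n, f (N i), fun g => Finset.prod_pos fun i _ => hf _,
    hτ, fun g => ?_⟩
  induction g with
  | zero => intro _; simp [hN]
  | succ g ih =>
    intro hg
    rw [← ih (by omega)]
    simp only
    rw [hτ g (by omega), ← Nat.mul_assoc]

/-- A word of a suitable cost has a prefix that is not a concatenation of `k` palindromes. -/
theorem exists_prefix_not_palindromic (k : ℕ) : ∃ H > 0, ∀ W : List α, cost W = H →
    ∃ j < W.length, ¬ ∃ c : ℕ → ℕ, c 0 = 0 ∧ c k = j ∧ ∀ i < k, c i ≤ c (i + 1) ∧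
      c (i + 1) ≤ W.length ∧ (block W (c i) (c (i + 1))).reverse = block W (c i) (c (i + 1)) := by
  set C : ℕ := 6 ^ (k + 1) * 3 with hC
  have hC0 : 0 < C := by positivity
  set Q : ℕ → ℕ := fun N => (2 + 9 * 2 ^ (N * C)) ^ k + 1 with hQ
  have hQ1 : ∀ N, 1 ≤ Q N := fun N => Nat.le_add_left _ _
  obtain ⟨N, τ, hτ0, hτ, hN⟩ := exists_scales (fun N => C * (Q N * (k + 2) + 1))
    (fun N => by positivity) (k + 2)
  refine ⟨τ 0, hτ0 0, fun W hW => ?_⟩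
  have hstep : ∀ g < k + 2, τ (g + 1) ≤ τ g := by
    intro g hg
    rw [hτ g hg]
    exact Nat.le_mul_of_pos_left _ (by positivity)
  have hanti : ∀ g g', g ≤ g' → g' ≤ k + 2 → τ g' ≤ τ g := by
    intro g g' h
    induction g', h using Nat.le_induction with
    | base => intro _; exact le_rfl
    | succ g' h ih => intro h'; exact (hstep g' (by omega)).trans (ih (by omega))
  have hsτ : ∀ g < k + 2, Q (N g) * (k + 2) * τ (g + 1) ≤ τ g := by
    intro g hg
    rw [hτ g hg]
    apply Nat.mul_le_mul_right
    exact (Nat.le_succ _).trans (Nat.le_mul_of_pos_left _ hC0)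
  -- The intervals are nested: stage `g` already excludes paths avoiding any of the first `g` gaps,
  -- and keeps enough cost for the next scale.
  have main : ∀ g ≤ k + 1, ∃ p q, q ≤ W.length ∧
      Q (N g) * (k + 2) * τ (g + 1) ≤ blockCost W p q ∧
      ∀ g' < g, ∀ j, p ≤ j → j < q → ∀ c, ¬ PalPath W (τ (g' + 1)) (τ g') k j c := by
    intro g
    induction g with
    | zero =>
      intro _
      refine ⟨0, W.length, le_rfl, ?_, by simp⟩
      rw [blockCost, block_self_length, hW]
      exact hsτ 0 (by omega)
    | succ g ih =>
      intro hg
      obtain ⟨p, q, hq, hpq, hav⟩ := ih (by omega)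
      have ht := hτ0 (g + 1)
      have hs' := hsτ (g + 1) (by omega)
      set s := Q (N (g + 1)) * (k + 2) * τ (g + 1 + 1) with hs
      have hs0 : 0 < s := Nat.mul_pos (Nat.mul_pos (hQ1 _) (by omega)) (hτ0 _)
      set κ := (Q (N g) * (k + 2) + 1) * τ (g + 1) with hκ
      have hκτ : τ g = 6 ^ (k + 1) * (3 * κ) := by
        rw [hτ g (by omega), hκ, hC]; ring
      -- The factor `k + 2` pays for `k * τ (g + 1)`, for `1`, and for `s`, the latter two being at
      -- most `τ (g + 1)`.
      have hbound : Q (N g) * (k * τ (g + 1) + 1 + s) ≤ Q (N g) * (k + 2) * τ (g + 1) := by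
        rw [Nat.mul_assoc]
        apply Nat.mul_le_mul_left
        rw [Nat.add_mul]
        omega
      have hκeq : κ = Q (N g) * (k + 2) * τ (g + 1) + τ (g + 1) := by rw [hκ]; ring
      have hk : k * τ (g + 1) ≤ κ := by
        rw [hκ]
        apply Nat.mul_le_mul_right
        have := Nat.le_mul_of_pos_left (k + 2) (hQ1 (N g))
        omega
      obtain ⟨p', q', h1, h2, h3, h4⟩ := exists_not_palPath (W := W) (κ := κ) (m := N g * C)
        (lo := τ (g + 1)) (k := k) (s := s) (p := p) (q := q) (by omega)
        (by rw [hW, ← hN g (by omega), hκτ, hC]; apply le_of_eq; ring) (by omega)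
        (by rw [← hκτ, hW]; exact hanti 0 g (Nat.zero_le _) (by omega)) hs0
        (lt_of_le_of_lt hbound (by omega)) hq (hbound.trans hpq)
      refine ⟨p', q', h2.trans hq, h3, fun g' hg' j hj hjq => ?_⟩
      rcases (Nat.lt_succ_iff.1 hg').eq_or_lt with rfl | hlt
      · rw [hκτ]
        exact h4 j hj hjq
      · exact hav g' hlt j (by omega) (by omega)
  obtain ⟨p, q, hq, hpq, hav⟩ := main (k + 1) le_rfl
  have hpos : 0 < Q (N (k + 1)) * (k + 2) * τ (k + 1 + 1) :=
    Nat.mul_pos (Nat.mul_pos (hQ1 _) (by omega)) (hτ0 _)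
  have hpq' : p < q := by
    by_contra! h
    rw [blockCost_of_le W h] at hpq
    omega
  refine ⟨p, by omega, ?_⟩
  rintro ⟨c, c0, ck, hc⟩
  -- A path to `p` must have a block with cost strictly inside each gap. The `k + 1` gaps are
  -- disjoint and there are only `k` blocks.
  have hgap : ∀ g < k + 1, ∃ i < k, τ (g + 1) < blockCost W (c i) (c (i + 1)) ∧
      blockCost W (c i) (c (i + 1)) < τ g := by
    intro g hg
    by_contra! hno
    refine hav g hg p le_rfl hpq' c ⟨c0, ck, fun i hi => ?_⟩
    obtain ⟨h1, h2, h3⟩ := hc i hi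
    refine ⟨h1, h2, h3, ?_⟩
    rcases le_or_gt (blockCost W (c i) (c (i + 1))) (τ (g + 1)) with h | h
    · exact Or.inl h
    · exact Or.inr (hno i hi h)
  choose! φ hφ hφ1 hφ2 using hgap
  obtain ⟨g, hg, g', hg', hne, he⟩ := Finset.exists_ne_map_eq_of_card_lt_of_maps_to
    (s := Finset.range (k + 1)) (t := Finset.range k) (f := φ) (by simp)
    (fun g hg => by
      simp only [Finset.coe_range, Set.mem_Iio] at hg ⊢
      exact hφ g hg)
  rw [Finset.mem_range] at hg hg'
  have key : ∀ g g', g < k + 1 → g' < k + 1 → φ g = φ g' → ¬ g < g' := by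
    intro g g' hg hg' he hlt
    have h1 := hφ1 g hg
    have h2 := hφ2 g' hg'
    rw [← he] at h2
    have h3 := hanti (g + 1) g' hlt (by omega)
    omega
  have h1 := key g g' hg hg' he
  have h2 := key g' g hg' hg he.symm
  omega

theorem block_middle (A B C : List α) :
    block (A ++ (B ++ C)) A.length (A.length + B.length) = B := by
  simp [block, List.take_append]

/-- A word of palindromic length at most `k` is cut by `k` possibly empty palindromes. -/
theorem exists_palindromic_borders {W : List α} {j k : ℕ} (hj : j ≤ W.length)
    (hk : palindromicLength (W.take j) ≤ k) :
    ∃ c : ℕ → ℕ, c 0 = 0 ∧ c k = j ∧ ∀ i < k, c i ≤ c (i + 1) ∧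
      c (i + 1) ≤ W.length ∧ (block W (c i) (c (i + 1))).reverse = block W (c i) (c (i + 1)) := by
  obtain ⟨ps, hps, hpal, hflat⟩ := exists_factorization_length_eq_palindromicLength (W.take j)
  have hlen : ps.flatten.length = j := by rw [hflat, List.length_take, min_eq_left hj]
  have hle : ∀ i, (ps.take i).flatten.length ≤ j := by
    intro i
    rw [← hlen]
    conv_rhs => rw [← List.take_append_drop i ps, List.flatten_append, List.length_append]
    exact Nat.le_add_right _ _
  -- Beyond `ps.length` the border stays at `j`, padding the factorization with empty blocks to
  -- exactly `k`.
  refine ⟨fun i => (ps.take i).flatten.length, by simp, ?_, fun i _ => ?_⟩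
  · simp only
    rw [List.take_of_length_le (by omega), hlen]
  · simp only
    rcases lt_or_ge i ps.length with hi | hi
    · have h1 : ps.take (i + 1) = ps.take i ++ [ps[i]] := (List.take_concat_get' ps i hi).symm
      have h2 : W = (ps.take i).flatten ++ (ps[i] ++ ((ps.drop (i + 1)).flatten ++ W.drop j)) := by
        have h3 : (ps.take (i + 1)).flatten ++ (ps.drop (i + 1)).flatten = W.take j := by
          rw [← List.flatten_append, List.take_append_drop, hflat]
        rw [h1, List.flatten_append, List.flatten_singleton] at h3
        conv_lhs => rw [← List.take_append_drop j W, ← h3]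
        simp
      have h4 : (ps.take (i + 1)).flatten.length
          = (ps.take i).flatten.length + (ps[i]).length := by
        rw [h1, List.flatten_append, List.length_append, List.flatten_singleton]
      refine ⟨by omega, (hle _).trans hj, ?_⟩
      have h5 : block W (ps.take i).flatten.length (ps.take (i + 1)).flatten.length = ps[i] := by
        rw [h4]
        conv_lhs => rw [h2]
        exact block_middle _ _ _
      rw [h5]
      exact (hpal _ (List.getElem_mem hi)).2
    · rw [List.take_of_length_le hi, List.take_of_length_le (hi.trans (Nat.le_succ i)),
        block_of_le W le_rfl]
      exact ⟨le_rfl, by rw [hlen]; exact hj, rfl⟩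

/-! ### Bounded cost implies ultimate periodicity -/

theorem one_le_cost {w : List α} (hw : w ≠ []) : 1 ≤ cost w := by
  by_contra! h
  exact hw ((hasCost_cost w).eq_nil (by omega))

/-- A word of cost at most `h` which has two consecutive blocks of cost `h` is periodic. -/
theorem HasCost.exists_period {a h : ℕ} {P Q U : List α} (hU : HasCost a U) (ha : a ≤ h)
    (hPQ : U = P ++ Q) (hP : h ≤ cost P) (hQ : h ≤ cost Q) (hh : 0 < h) :
    ∃ p, 0 < p ∧ p ≤ P.length ∧ ∀ i, i + p < U.length → U[i]? = U[i + p]? := by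
  have hP0 : P ≠ [] := by rintro rfl; rw [cost_nil] at hP; omega
  have hQ0 : Q ≠ [] := by rintro rfl; rw [cost_nil] at hQ; omega
  induction hU with
  | nil =>
    exact absurd (List.append_eq_nil_iff.1 hPQ.symm).1 hP0
  | letter a =>
    have := congrArg List.length hPQ
    have h1 := List.length_pos_iff.2 hP0
    have h2 := List.length_pos_iff.2 hQ0
    simp at this
    omega
  | @append a b u v hu hv ihu ihv =>
    -- Wherever the cut falls, one piece contains `P` or `Q` and uses up the whole cost `h`; the
    -- other costs nothing and is empty.
    rcases List.append_eq_append_iff.1 hPQ with ⟨t, rfl, rfl⟩ | ⟨t, rfl, rfl⟩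
    · have h1 := cost_mono (List.suffix_append t Q).isInfix
      have h2 := hv.cost_le
      obtain rfl := hu.eq_nil (by omega)
      exact ihv (by omega) rfl
    · have h1 := cost_mono (List.prefix_append P t).isInfix
      have h2 := hu.cost_le
      have h3 := hv.eq_nil (by omega)
      rw [h3, List.append_nil]
      exact ihu (by omega) (by rw [h3, List.append_nil])
  | @run a v w hv hr _ =>
    obtain ⟨hv0, s, hs⟩ := hr
    have hvpos : 0 < v.length := List.length_pos_iff.2 hv0
    refine ⟨v.length, hvpos, ?_, fun i hi => ?_⟩
    -- A `P` shorter than `v` would be a factor of `v ++ v`, of cost at most `2 * a`, while `3 * a ≤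
    -- h`. Here the factor 3 in the cost of a run has to exceed 2.
    · by_contra! hlt
      have hinf : P <:+: v ++ v := by
        have : block (v ++ v) (s % v.length) (s % v.length + P.length) = P := by
          have hsv := Nat.mod_lt s hvpos
          apply List.ext_getElem?
          intro i
          rw [getElem?_block]
          split_ifs with hi
          · have h1 : P[i]? = w[i]? := by
              rw [hPQ, List.getElem?_append_left (by omega)]
            have h2 : i < w.length := by rw [hPQ, List.length_append]; omega
            rw [h1, hs i h2, ← Nat.mod_add_mod]
            rcases lt_or_ge (s % v.length + i) v.length with h | h
            · rw [List.getElem?_append_left h, Nat.mod_eq_of_lt h]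
            · rw [List.getElem?_append_right h, Nat.mod_eq_sub_mod h,
                Nat.mod_eq_of_lt (by omega : s % v.length + i - v.length < v.length)]
          · rw [List.getElem?_eq_none (by omega)]
        rw [← this]
        exact block_infix _ _ _
      have h1 := cost_mono hinf
      have h2 := cost_append_le v v
      have h3 := hv.cost_le
      omega
    · rw [hs i (by omega), hs _ hi, ← Nat.add_assoc, Nat.add_mod_right]

theorem getElem?_add_mul {U : List α} {p : ℕ} (hp : ∀ i, i + p < U.length → U[i]? = U[i + p]?)
    (n i : ℕ) (h : i + p * n < U.length) : U[i]? = U[i + p * n]? := by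
  induction n with
  | zero => rfl
  | succ n ih =>
    rw [Nat.mul_succ] at h ⊢
    rw [ih (by omega), hp _ (by omega), Nat.add_assoc]

theorem eq_cycle {y : Stream' α} {p : ℕ} (hp : 0 < p) (hy : ∀ i, y.get i = y.get (i + p))
    (h : y.take p ≠ []) : y = Stream'.cycle (y.take p) h := by
  have hlen : (y.take p).length = p := Stream'.length_take _ _
  apply Stream'.ext
  intro n
  induction n using Nat.strong_induction_on with
  | _ n ih =>
    rw [Stream'.cycle_eq]
    rcases lt_or_ge n p with hn | hn
    · rw [Stream'.get_append_left _ _ _ (by omega), Stream'.take_get]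
    · have h1 := Stream'.drop_append_stream (y.take p) (Stream'.cycle (y.take p) h)
      have h2 := congrArg (fun z => Stream'.get z (n - p)) h1
      simp only [Stream'.get_drop, hlen] at h2
      rw [Nat.add_sub_cancel' hn] at h2
      rw [h2, ← ih (n - p) (by omega), hy (n - p), Nat.sub_add_cancel hn]

theorem isUltimatelyPeriodic_of_get {x : Stream' α} {m p : ℕ} (hp : 0 < p)
    (h : ∀ i, x.get (m + i) = x.get (m + i + p)) : IsUltimatelyPeriodic x := by
  have hne : (x.drop m).take p ≠ [] := by
    rw [← List.length_pos_iff, Stream'.length_take]; exact hp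
  refine ⟨x.take m, (x.drop m).take p, hne, ?_⟩
  rw [← eq_cycle hp (fun i => by rw [Stream'.get_drop, Stream'.get_drop, h, add_assoc]) hne,
    Stream'.append_take_drop]

theorem take_infix_take (x : Stream' α) {a b n n' : ℕ} (hab : a ≤ b) (h : b + n ≤ a + n') :
    (x.drop b).take n <:+: (x.drop a).take n' := by
  rw [infix_iff_block]
  simp only [Stream'.length_take]
  refine ⟨b - a, by omega, ?_⟩
  apply List.ext_getElem?
  intro i
  rw [getElem?_block]
  split_ifs with hi
  · rw [Stream'.getElem?_take (by omega), Stream'.getElem?_take (by omega), Stream'.get_drop,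
      Stream'.get_drop]
    congr 2; omega
  · rw [List.getElem?_eq_none]
    rw [Stream'.length_take]; omega

/-- An infinite word is ultimately periodic if the costs of its factors are bounded. -/
theorem isUltimatelyPeriodic_of_cost_le {x : Stream' α} {B : ℕ}
    (hB : ∀ i n, cost ((x.drop i).take n) ≤ B) : IsUltimatelyPeriodic x := by
  classical
  have hex : ∃ h, ¬ ∀ m, ∃ i ≥ m, ∃ n, h ≤ cost ((x.drop i).take n) := by
    refine ⟨B + 1, fun hcon => ?_⟩
    obtain ⟨i, -, n, hn⟩ := hcon 0
    have := hB i n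
    omega
  -- `h` is the largest cost reached by factors arbitrarily far out: some tail has no factor of
  -- larger cost, yet contains disjoint factors of cost `h`.
  obtain ⟨h, hh⟩ : ∃ h, h + 1 = Nat.find hex := by
    refine ⟨Nat.find hex - 1, Nat.sub_add_cancel ?_⟩
    rw [Nat.succ_le_iff, Nat.find_pos]
    exact fun hcon => hcon fun m => ⟨m, le_rfl, 0, Nat.zero_le _⟩
  have hlt : ∀ h' < h + 1, ∀ m, ∃ i ≥ m, ∃ n, h' ≤ cost ((x.drop i).take n) := by
    intro h' hlt
    rw [hh] at hlt
    exact not_not.1 (Nat.find_min hex hlt)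
  obtain ⟨m, hm⟩ : ∃ m, ∀ i ≥ m, ∀ n, cost ((x.drop i).take n) ≤ h := by
    have := Nat.find_spec hex
    rw [← hh] at this
    push Not at this
    obtain ⟨m, hm⟩ := this
    exact ⟨m, fun i hi n => Nat.lt_succ_iff.1 (hm i hi n)⟩
  have hpos : 0 < h := by
    have h1 := hm m le_rfl 1
    have h2 : 1 ≤ cost ((x.drop m).take 1) := one_le_cost (by
      rw [← List.length_pos_iff, Stream'.length_take]; exact one_pos)
    omega
  obtain ⟨i₁, hi₁, n₁, hn₁⟩ := hlt h (Nat.lt_succ_self h) m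
  obtain ⟨i₂, hi₂, n₂, hn₂⟩ := hlt h (Nat.lt_succ_self h) (i₁ + n₁)
  set L := i₁ + n₁ - m with hL
  -- The period found depends on the finite window, but it is at most `L`, so `L.factorial` is a
  -- multiple of it for every window.
  apply isUltimatelyPeriodic_of_get (m := m) (p := L.factorial) (Nat.factorial_pos _)
  intro i
  set M := L + (i₂ + n₂) + i + L.factorial + 1 with hM
  set U := (x.drop m).take M with hU
  have hUlen : U.length = M := Stream'.length_take _ _
  have hUget : ∀ j < M, U[j]? = some (x.get (m + j)) := by
    intro j hj
    rw [hU, Stream'.getElem?_take hj, Stream'.get_drop]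
  have hsplit : U = (x.drop m).take L ++ (x.drop (m + L)).take (M - L) := by
    apply List.ext_getElem?
    intro j
    rcases lt_or_ge j M with hj | hj
    · rw [hUget j hj]
      rcases lt_or_ge j L with hjL | hjL
      · rw [List.getElem?_append_left (by rwa [Stream'.length_take]), Stream'.getElem?_take hjL,
          Stream'.get_drop]
      · rw [List.getElem?_append_right (by rwa [Stream'.length_take]), Stream'.length_take,
          Stream'.getElem?_take (by omega), Stream'.get_drop]
        congr 2; omega
    · rw [List.getElem?_eq_none (by omega), List.getElem?_eq_none]
      rw [List.length_append, Stream'.length_take, Stream'.length_take]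
      omega
  obtain ⟨p, hp0, hpL, hp⟩ := (hasCost_cost U).exists_period (hm m le_rfl M) hsplit
    (hn₁.trans (cost_mono (take_infix_take x hi₁ (by omega))))
    (hn₂.trans (cost_mono (take_infix_take x (by omega) (by omega)))) hpos
  rw [Stream'.length_take] at hpL
  obtain ⟨q, hq⟩ := Nat.dvd_factorial hp0 hpL
  have key := getElem?_add_mul hp q i (by omega)
  rw [← hq, hUget _ (by omega), hUget _ (by omega), ← Nat.add_assoc] at key
  exact Option.some_injective _ key

/-- The palindromic length is unbounded on the factors of a word that is not ultimately
periodic. -/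
theorem isUltimatelyPeriodic_of_palindromicLength_le {x : Stream' α} {k : ℕ}
    (hk : ∀ u, IsNonemptyFactor u x → palindromicLength u ≤ k) : IsUltimatelyPeriodic x := by
  obtain ⟨H, -, hH⟩ := exists_prefix_not_palindromic (α := α) k
  apply isUltimatelyPeriodic_of_cost_le (B := H)
  intro i n
  by_contra! hlt
  set V := (x.drop i).take n with hV
  -- A factor that is too expensive has a prefix of cost exactly `H`.
  obtain ⟨e, heV, he, -⟩ := exists_blockCost_eq (W := V) (a := 0) le_rfl
    (t := H) (by rw [blockCost, block_self_length]; exact hlt.le)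
  have hlen : V.length = n := Stream'.length_take _ _
  have hW : block V 0 e = (x.drop i).take e := by
    rw [block, List.drop_zero, hV, Stream'.take_take, min_eq_right (by omega)]
  obtain ⟨j, hj, hno⟩ := hH _ he
  apply hno
  rcases Nat.eq_zero_or_pos j with rfl | hj0
  · exact ⟨fun _ => 0, rfl, rfl, fun _ _ => ⟨le_rfl, Nat.zero_le _, by simp [block_of_le]⟩⟩
  · apply exists_palindromic_borders hj.le
    rw [hW, Stream'.length_take] at hj
    rw [hW, Stream'.take_take, min_eq_right hj.le]
    refine hk _ ⟨?_, i, j, rfl⟩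
    rw [← List.length_pos_iff, Stream'.length_take]
    exact hj0

end PowerCost

theorem mainTheorem1 {α : Type*} (x : Stream' α) :
    (∀ k : ℤ, (∀ u : List α, IsNonemptyFactor u x → (palindromicLength u : ℤ) ≤ k) →
      IsUltimatelyPeriodic x) ∧
    (IsAperiodic x →
      ∀ k : ℤ, ∃ u : List α, IsNonemptyFactor u x ∧ k < (palindromicLength u : ℤ)) := by
  have main : ∀ k : ℤ, (∀ u : List α, IsNonemptyFactor u x → (palindromicLength u : ℤ) ≤ k) →
      IsUltimatelyPeriodic x := fun k hk =>
    PowerCost.isUltimatelyPeriodic_of_palindromicLength_le (k := k.toNat) fun u hu => by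
      have := hk u hu
      omega
  refine ⟨main, fun hx k => ?_⟩
  by_contra! hcon
  exact hx (main k hcon)
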